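/- Let $g,t$ be positive integers and let $K$ be a set of positive integers. A $(gt,g,K,1)$-cyclic difference family is a family $\mathscr F$ of subsets (base blocks) of $\mathbb Z_{gt}=\mathbb Z/gt\mathbb Z$ such that (1) $|B|\in K$ for every $B\in\mathscr F$; and (2) the differences $x-y$, where $(x,y)$ runs over the ordered pairs of distinct elements of $B$ and $B$ runs over $\mathscr F$, taken with multiplicity, cover each element of $\mathbb Z_{gt}\setminus\{0,t,2t,\ldots,(g-1)t\}$ exactly once and cover no element of $\{0,t,2t,\ldots,(g-1)t\}$. **Lemma.** For every odd integer $t\ge 7$ with $t\ne 11$ there exists a $(4t,4,\{3,5\},1)$-cyclic difference family. -/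

import Mathlib

/-- The list (with multiplicity) `ΔB` of the differences `x - y` of ordered pairs of distinct
elements `x, y` of a finite subset `B` of `ℤ/v`. -/
def differenceList {v : ℕ} (B : Finset (ZMod v)) : Multiset (ZMod v) :=
  B.offDiag.val.map fun p => p.1 - p.2

/-- `𝓕` is the family of base blocks of a `(gt, g, K, 1)`-cyclic difference family, for positive
integers `g` and `t`: every base block is a subset of `ℤ/gt` whose size lies in `K`, and the
differences of the base blocks, taken together and with multiplicity, cover each element of
`ℤ/gt` outside `{0, t, 2t, …, (g-1)t}` exactly once and no element of `{0, t, 2t, …, (g-1)t}`. -/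
structure IsCyclicDifferenceFamily (g t : ℕ) (K : Set ℕ)
    (𝓕 : Multiset (Finset (ZMod (g * t)))) : Prop where
  card_mem : ∀ B ∈ 𝓕, B.card ∈ K
  count_eq_one : ∀ d : ZMod (g * t), (¬ ∃ i : ℕ, i < g ∧ d = ((i * t : ℕ) : ZMod (g * t))) →
    (𝓕.bind differenceList).count d = 1
  count_eq_zero : ∀ d : ZMod (g * t), (∃ i : ℕ, i < g ∧ d = ((i * t : ℕ) : ZMod (g * t))) →
    (𝓕.bind differenceList).count d = 0

/-! Up to sign, the `2t - 2` values `0 < x < 2t`, `x ≠ t`, must be covered. The total number of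
differences is exactly `4t - 4`, so covering suffices. The triples `{0, 2i, t + i}` use small even
numbers and an interval centred at `t`; the triples `{0, 2j + 1, s + j}` use small odd numbers and
an interval around `s`. A triple covers 3 values and a quintuple 10, so modulo 3 the number of
quintuples is `2t - 2`: none, one or two are used for `t ≡ 1, 3, 5` mod 6. They and a few sporadic
triples absorb the values left when the regular families are shortened at their ends. -/

/-- A family whose blocks have the right sizes, whose number of differences is `4t - 4`, and whose
differences cover everything outside the subgroup `{0, t, 2t, 3t}`, is a cyclic difference family:
there is no room for repetitions. -/
theorem isCyclicDifferenceFamily_of_covers {t : ℕ} (ht : 0 < t) {K : Set ℕ}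
    {𝓕 : Multiset (Finset (ZMod (4 * t)))} (hK : ∀ B ∈ 𝓕, B.card ∈ K)
    (hcard : (𝓕.map fun B => B.card * (B.card - 1)).sum = 4 * t - 4)
    (hcov : ∀ d : ZMod (4 * t), (¬ ∃ i : ℕ, i < 4 ∧ d = ((i * t : ℕ) : ZMod (4 * t))) →
      d ∈ 𝓕.bind differenceList) :
    IsCyclicDifferenceFamily 4 t K 𝓕 := by
  classical
  have : NeZero (4 * t) := ⟨by omega⟩
  set H : Finset (ZMod (4 * t)) :=
    (Finset.range 4).image fun i : ℕ => ((i * t : ℕ) : ZMod (4 * t)) with hH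
  have memH : ∀ d, d ∈ H ↔ ∃ i : ℕ, i < 4 ∧ d = ((i * t : ℕ) : ZMod (4 * t)) := by
    intro d
    simp only [hH, Finset.mem_image, Finset.mem_range, eq_comm]
  have hHcard : H.card ≤ 4 := by
    exact Finset.card_image_le.trans_eq (Finset.card_range 4)
  have hle : Hᶜ.val ≤ 𝓕.bind differenceList := by
    rw [Multiset.le_iff_subset Hᶜ.nodup]
    intro d hd
    refine hcov d fun h => ?_
    exact Finset.mem_compl.1 hd ((memH d).2 h)
  have htotal : (𝓕.bind differenceList).card = 4 * t - 4 := by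
    rw [Multiset.card_bind, ← hcard]
    congr 1
    refine Multiset.map_congr rfl fun B _ => ?_
    simp [differenceList, Finset.offDiag_card, Nat.mul_sub]
  have heq : Hᶜ.val = 𝓕.bind differenceList := by
    refine Multiset.eq_of_le_of_card_le hle ?_
    rw [htotal, Finset.card_val, Finset.card_compl, ZMod.card]
    omega
  refine ⟨hK, fun d hd => ?_, fun d hd => ?_⟩
  · rw [← heq, Multiset.count_eq_one_of_mem Hᶜ.nodup]
    exact Finset.mem_compl.2 fun h => hd ((memH d).1 h)
  · rw [← heq, Multiset.count_eq_zero]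
    exact fun h => Finset.mem_compl.1 h ((memH d).2 hd)

/-- The same criterion for blocks given by representatives in `[0, 4t)`: it is enough that every
`x < 2t` other than `0` and `t` is, up to sign, a difference modulo `4t`. -/
theorem exists_isCyclicDifferenceFamily_of_nat {t : ℕ} (ht : 0 < t) {K : Set ℕ}
    (L : List (Finset ℕ)) (hlt : ∀ B ∈ L, ∀ a ∈ B, a < 4 * t) (hK : ∀ B ∈ L, B.card ∈ K)
    (hcard : (L.map fun B => B.card * (B.card - 1)).sum = 4 * t - 4)
    (hcov : ∀ x, 0 < x → x < 2 * t → x ≠ t →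
      ∃ B ∈ L, ∃ a ∈ B, ∃ b ∈ B, b + x = a ∨ b + x = a + 4 * t) :
    ∃ 𝓕 : Multiset (Finset (ZMod (4 * t))), IsCyclicDifferenceFamily 4 t K 𝓕 := by
  classical
  have : NeZero (4 * t) := ⟨by omega⟩
  let red : Finset ℕ → Finset (ZMod (4 * t)) := fun B => B.image fun a : ℕ => (a : ZMod (4 * t))
  have hred : ∀ B ∈ L, (red B).card = B.card := by
    intro B hB
    refine Finset.card_image_of_injOn fun a ha b hb hab => ?_
    have := (ZMod.natCast_eq_natCast_iff' a b (4 * t)).1 hab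
    rwa [Nat.mod_eq_of_lt (hlt B hB a ha), Nat.mod_eq_of_lt (hlt B hB b hb)] at this
  refine ⟨(L.map red : List _), isCyclicDifferenceFamily_of_covers ht ?_ ?_ ?_⟩
  · intro B hB
    obtain ⟨C, hC, rfl⟩ := List.mem_map.1 (Multiset.mem_coe.1 hB)
    rw [hred C hC]
    exact hK C hC
  · rw [Multiset.map_coe, Multiset.sum_coe, ← hcard, List.map_map]
    congr 1
    refine List.map_congr_left fun B hB => ?_
    simp [hred B hB]
  · have pos : ∀ x, 0 < x → x < 2 * t → x ≠ t →
        (x : ZMod (4 * t)) ∈ (↑(L.map red) : Multiset _).bind differenceList ∧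
        -(x : ZMod (4 * t)) ∈ (↑(L.map red) : Multiset _).bind differenceList := by
      intro x h0 h2 h1
      obtain ⟨B, hB, a, ha, b, hb, hab⟩ := hcov x h0 h2 h1
      have hab' : (a : ZMod (4 * t)) - b = x := by
        rw [sub_eq_iff_eq_add']
        rcases hab with h | h
        · rw [← h]; push_cast; rfl
        · have := congrArg (Nat.cast : ℕ → ZMod (4 * t)) h
          rw [Nat.cast_add, Nat.cast_add a, ZMod.natCast_self, add_zero] at this
          exact this.symm
      have hne : (a : ZMod (4 * t)) ≠ b := by
        intro h
        rw [h, sub_self, eq_comm, ZMod.natCast_eq_zero_iff] at hab'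
        have := Nat.le_of_dvd h0 hab'
        omega
      have hBL : red B ∈ (↑(L.map red) : Multiset (Finset (ZMod (4 * t)))) :=
        Multiset.mem_coe.2 (List.mem_map_of_mem hB)
      have ha' : (a : ZMod (4 * t)) ∈ red B := Finset.mem_image_of_mem _ ha
      have hb' : (b : ZMod (4 * t)) ∈ red B := Finset.mem_image_of_mem _ hb
      refine ⟨Multiset.mem_bind.2 ⟨_, hBL, Multiset.mem_map.2 ⟨(a, b), ?_, hab'⟩⟩,
        Multiset.mem_bind.2 ⟨_, hBL, Multiset.mem_map.2 ⟨(b, a), ?_, ?_⟩⟩⟩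
      · exact Finset.mem_offDiag.2 ⟨ha', hb', hne⟩
      · exact Finset.mem_offDiag.2 ⟨hb', ha', hne.symm⟩
      · simp [← hab']
    intro d hd
    have hdv : ((d.val : ℕ) : ZMod (4 * t)) = d := ZMod.natCast_zmod_val d
    have hdlt : d.val < 4 * t := ZMod.val_lt d
    have hmul : ∀ i, i < 4 → d.val ≠ i * t := fun i hi h => hd ⟨i, hi, by rw [← h, hdv]⟩
    have m0 := hmul 0 (by norm_num)
    have m1 := hmul 1 (by norm_num)
    have m2 := hmul 2 (by norm_num)
    have m3 := hmul 3 (by norm_num)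
    by_cases hlt2 : d.val < 2 * t
    · rw [← hdv]
      exact (pos d.val (by omega) hlt2 (by omega)).1
    · have hneg : -((4 * t - d.val : ℕ) : ZMod (4 * t)) = d := by
        rw [Nat.cast_sub hdlt.le, ZMod.natCast_self, zero_sub, neg_neg, hdv]
      rw [← hneg]
      exact (pos (4 * t - d.val) (by omega) (by omega) (by omega)).2

theorem card_zero_pair {b c : ℕ} (h : 0 < b) (hb : b < c) : ({0, b, c} : Finset ℕ).card = 3 :=
  Finset.card_eq_three.2 ⟨0, b, c, by omega, by omega, by omega, rfl⟩

theorem card_zero_quadruple {b c d e : ℕ} (h : 0 < b) (hb : b < c) (hc : c < d) (hd : d < e) :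
    ({0, b, c, d, e} : Finset ℕ).card = 5 := by
  repeat rw [Finset.card_insert_of_notMem (by simp; omega)]
  rfl

/-- The criterion for a family of quintuples `{0, b, c, d, e}` and triples `{0, b, c}`. -/
theorem exists_isCyclicDifferenceFamily_of_lists {t : ℕ} (ht : 0 < t)
    (Q : List (ℕ × ℕ × ℕ × ℕ)) (T : List (ℕ × ℕ))
    (hQ : ∀ q ∈ Q, 0 < q.1 ∧ q.1 < q.2.1 ∧ q.2.1 < q.2.2.1 ∧ q.2.2.1 < q.2.2.2 ∧
      q.2.2.2 < 4 * t)
    (hT : ∀ p ∈ T, 0 < p.1 ∧ p.1 < p.2 ∧ p.2 < 4 * t)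
    (hcount : 20 * Q.length + 6 * T.length = 4 * t - 4)
    (hcov : ∀ x, 0 < x → x < 2 * t → x ≠ t →
      (∃ q ∈ Q, ∃ a ∈ ({0, q.1, q.2.1, q.2.2.1, q.2.2.2} : Finset ℕ),
        ∃ b ∈ ({0, q.1, q.2.1, q.2.2.1, q.2.2.2} : Finset ℕ), b + x = a ∨ b + x = a + 4 * t) ∨
      ∃ p ∈ T, x = p.1 ∨ p.1 + x = p.2 ∨ x = p.2 ∨ p.2 + x = 4 * t) :
    ∃ 𝓕 : Multiset (Finset (ZMod (4 * t))), IsCyclicDifferenceFamily 4 t {3, 5} 𝓕 := by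
  have cQ : ∀ q ∈ Q, ({0, q.1, q.2.1, q.2.2.1, q.2.2.2} : Finset ℕ).card = 5 := fun q hq => by
    obtain ⟨h1, h2, h3, h4, -⟩ := hQ q hq
    exact card_zero_quadruple h1 h2 h3 h4
  have cT : ∀ p ∈ T, ({0, p.1, p.2} : Finset ℕ).card = 3 := fun p hp => by
    obtain ⟨h1, h2, -⟩ := hT p hp
    exact card_zero_pair h1 h2
  refine exists_isCyclicDifferenceFamily_of_nat ht
    (Q.map (fun q => {0, q.1, q.2.1, q.2.2.1, q.2.2.2}) ++ T.map (fun p => {0, p.1, p.2}))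
    ?_ ?_ ?_ ?_
  · intro B hB a ha
    rcases List.mem_append.1 hB with h | h
    · obtain ⟨q, hq, rfl⟩ := List.mem_map.1 h
      have := hQ q hq
      simp only [Finset.mem_insert, Finset.mem_singleton] at ha
      omega
    · obtain ⟨p, hp, rfl⟩ := List.mem_map.1 h
      have := hT p hp
      simp only [Finset.mem_insert, Finset.mem_singleton] at ha
      omega
  · intro B hB
    rcases List.mem_append.1 hB with h | h
    · obtain ⟨q, hq, rfl⟩ := List.mem_map.1 h
      simp [cQ q hq]
    · obtain ⟨p, hp, rfl⟩ := List.mem_map.1 h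
      simp [cT p hp]
  · rw [List.map_append, List.sum_append, List.map_map, List.map_map, ← hcount]
    have h1 : ∀ q ∈ Q, ((fun B : Finset ℕ => B.card * (B.card - 1)) ∘
        fun q : ℕ × ℕ × ℕ × ℕ => {0, q.1, q.2.1, q.2.2.1, q.2.2.2}) q = 20 :=
      fun q hq => by simp [Function.comp_apply, cQ q hq]
    have h2 : ∀ p ∈ T, ((fun B : Finset ℕ => B.card * (B.card - 1)) ∘
        fun p : ℕ × ℕ => {0, p.1, p.2}) p = 6 :=
      fun p hp => by simp [Function.comp_apply, cT p hp]
    rw [List.map_congr_left h1, List.map_congr_left h2]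
    simp [mul_comm]
  · intro x h0 h2 h1
    rcases hcov x h0 h2 h1 with ⟨q, hq, h⟩ | ⟨p, hp, h⟩
    · exact ⟨_, List.mem_append_left _ (List.mem_map_of_mem hq), h⟩
    · refine ⟨_, List.mem_append_right _ (List.mem_map_of_mem hp), ?_⟩
      rcases h with h | h | h | h
      · exact ⟨p.1, by simp, 0, by simp, by omega⟩
      · exact ⟨p.2, by simp, p.1, by simp, by omega⟩
      · exact ⟨p.2, by simp, 0, by simp, by omega⟩
      · exact ⟨0, by simp, p.2, by simp, by omega⟩

/-- The triples `{0, 2i, t + i}` for `l ≤ i < l + m`; up to sign, their differences are `2i` and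
`t ± i`. -/
def evenTriples (t l m : ℕ) : List (ℕ × ℕ) :=
  (List.range' l m).map fun i => (2 * i, t + i)

/-- The triples `{0, 2j + 1, s + j}` for `l ≤ j < l + m`; their differences are `2j + 1`, `s + j`
and `s - j - 1`. -/
def oddTriples (s l m : ℕ) : List (ℕ × ℕ) :=
  (List.range' l m).map fun j => (2 * j + 1, s + j)

theorem mem_evenTriples {t l m i : ℕ} (h : l ≤ i ∧ i < l + m) :
    (2 * i, t + i) ∈ evenTriples t l m :=
  List.mem_map.2 ⟨i, List.mem_range'_1.2 h, rfl⟩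

theorem mem_oddTriples {s l m j : ℕ} (h : l ≤ j ∧ j < l + m) :
    (2 * j + 1, s + j) ∈ oddTriples s l m :=
  List.mem_map.2 ⟨j, List.mem_range'_1.2 h, rfl⟩

theorem exists_of_mem_evenTriples {t l m : ℕ} {p : ℕ × ℕ} (h : p ∈ evenTriples t l m) :
    ∃ i, l ≤ i ∧ i < l + m ∧ p = (2 * i, t + i) := by
  obtain ⟨i, hi, rfl⟩ := List.mem_map.1 h
  exact ⟨i, (List.mem_range'_1.1 hi).1, (List.mem_range'_1.1 hi).2, rfl⟩

theorem exists_of_mem_oddTriples {s l m : ℕ} {p : ℕ × ℕ} (h : p ∈ oddTriples s l m) :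
    ∃ j, l ≤ j ∧ j < l + m ∧ p = (2 * j + 1, s + j) := by
  obtain ⟨j, hj, rfl⟩ := List.mem_map.1 h
  exact ⟨j, (List.mem_range'_1.1 hj).1, (List.mem_range'_1.1 hj).2, rfl⟩

/-- The criterion for quintuples `Q`, sporadic triples `S`, and the two regular families of
triples. -/
theorem exists_isCyclicDifferenceFamily_of_regular {t s l m l' m' : ℕ} (ht : 0 < t)
    (Q : List (ℕ × ℕ × ℕ × ℕ)) (S : List (ℕ × ℕ))
    (hQ : ∀ q ∈ Q, 0 < q.1 ∧ q.1 < q.2.1 ∧ q.2.1 < q.2.2.1 ∧ q.2.2.1 < q.2.2.2 ∧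
      q.2.2.2 < 4 * t)
    (hS : ∀ p ∈ S, 0 < p.1 ∧ p.1 < p.2 ∧ p.2 < 4 * t)
    (hl : 0 < l) (hm : l + m ≤ t) (hs : l' + m' < s) (hs' : s + (l' + m') ≤ 4 * t)
    (hcount : 20 * Q.length + 6 * (S.length + m + m') = 4 * t - 4)
    (hcov : ∀ x, 0 < x → x < 2 * t → x ≠ t →
      (∃ q ∈ Q, ∃ a ∈ ({0, q.1, q.2.1, q.2.2.1, q.2.2.2} : Finset ℕ),
        ∃ b ∈ ({0, q.1, q.2.1, q.2.2.1, q.2.2.2} : Finset ℕ), b + x = a ∨ b + x = a + 4 * t) ∨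
      (∃ p ∈ S, x = p.1 ∨ p.1 + x = p.2 ∨ x = p.2 ∨ p.2 + x = 4 * t) ∨
      (∃ i, (l ≤ i ∧ i < l + m) ∧ (x = 2 * i ∨ x + i = t ∨ x = t + i)) ∨
      ∃ j, (l' ≤ j ∧ j < l' + m') ∧ (x = 2 * j + 1 ∨ x + j + 1 = s ∨ x = s + j)) :
    ∃ 𝓕 : Multiset (Finset (ZMod (4 * t))), IsCyclicDifferenceFamily 4 t {3, 5} 𝓕 := by
  refine exists_isCyclicDifferenceFamily_of_lists ht Q
    (S ++ (evenTriples t l m ++ oddTriples s l' m')) hQ ?_ ?_ ?_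
  · intro p hp
    simp only [List.mem_append] at hp
    rcases hp with hp | hp | hp
    · exact hS p hp
    · obtain ⟨i, h1, h2, rfl⟩ := exists_of_mem_evenTriples hp
      dsimp only
      omega
    · obtain ⟨j, h1, h2, rfl⟩ := exists_of_mem_oddTriples hp
      dsimp only
      omega
  · simp only [List.length_append, evenTriples, oddTriples, List.length_map, List.length_range']
    omega
  · intro x h0 h2 h1
    rcases hcov x h0 h2 h1 with h | ⟨p, hp, h⟩ | ⟨i, hi, h⟩ | ⟨j, hj, h⟩
    · exact Or.inl h
    · exact Or.inr ⟨p, List.mem_append_left _ hp, h⟩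
    · refine Or.inr ⟨_, List.mem_append_right _ (List.mem_append_left _ (mem_evenTriples hi)), ?_⟩
      dsimp only
      omega
    · refine Or.inr ⟨_, List.mem_append_right _ (List.mem_append_right _ (mem_oddTriples hj)), ?_⟩
      dsimp only
      omega

/-! ### Constructions by the residue of `t` modulo 6 -/

theorem exists_isCyclicDifferenceFamily_six_mul_add_one {k : ℕ} (hk : 1 ≤ k) :
    ∃ 𝓕 : Multiset (Finset (ZMod (4 * (6 * k + 1)))),
      IsCyclicDifferenceFamily 4 (6 * k + 1) {3, 5} 𝓕 := by
  -- The even triples fill `[4k+1, 8k+1]` except `t`; this `s` makes the odd ones fill the rest,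
  -- `[8k+2, 12k+1]`.
  refine exists_isCyclicDifferenceFamily_of_regular (s := 10 * k + 2) (l := 1) (m := 2 * k)
    (l' := 0) (m' := 2 * k) (by omega) [] [] (by simp) (by simp) (by omega) (by omega) (by omega)
    (by omega) (by simp only [List.length_nil]; omega) fun x h0 h2 h1 => Or.inr (Or.inr ?_)
  rcases le_or_gt x (4 * k) with h | h
  · rcases Nat.even_or_odd' x with ⟨i, rfl | rfl⟩
    · exact Or.inl ⟨i, by omega, by omega⟩
    · exact Or.inr ⟨i, by omega, by omega⟩
  rcases lt_or_ge x (6 * k + 1) with h3 | h3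
  · exact Or.inl ⟨6 * k + 1 - x, by omega, by omega⟩
  rcases le_or_gt x (8 * k + 1) with h4 | h4
  · exact Or.inl ⟨x - (6 * k + 1), by omega, by omega⟩
  rcases lt_or_ge x (10 * k + 2) with h5 | h5
  · exact Or.inr ⟨10 * k + 1 - x, by omega, by omega⟩
  · exact Or.inr ⟨x - (10 * k + 2), by omega, by omega⟩

/-- The regular triples leave 16 values: 10 for the quintuple, 6 for two sporadic triples. For `k =
1` the length `2k - 3` would be negative. -/
theorem exists_isCyclicDifferenceFamily_six_mul_add_three {k : ℕ} (hk : 2 ≤ k) :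
    ∃ 𝓕 : Multiset (Finset (ZMod (4 * (6 * k + 3)))),
      IsCyclicDifferenceFamily 4 (6 * k + 3) {3, 5} 𝓕 := by
  refine exists_isCyclicDifferenceFamily_of_regular (s := 10 * k + 6) (l := 1) (m := 2 * k - 1)
    (l' := 2) (m' := 2 * k - 3) (by omega) [(1, 4 * k, 4 * k + 3, 14 * k + 7)]
    [(8 * k + 3, 16 * k + 7), (4 * k + 1, 12 * k + 7)] (by simp; omega) (by simp; omega)
    (by omega) (by omega) (by omega) (by omega)
    (by simp only [List.length_cons, List.length_nil]; omega) fun x h0 h2 h1 => ?_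
  by_cases hS : x = 8 * k + 3 ∨ x = 8 * k + 4 ∨ x = 8 * k + 5 ∨ x = 4 * k + 1 ∨ x = 8 * k + 6 ∨
      x = 12 * k + 5
  · right; left
    simp only [List.mem_cons, List.not_mem_nil, or_false, exists_eq_or_imp, exists_eq_left]
    omega
  by_cases hE : ∃ i, (1 ≤ i ∧ i < 1 + (2 * k - 1)) ∧
      (x = 2 * i ∨ x + i = 6 * k + 3 ∨ x = 6 * k + 3 + i)
  · exact Or.inr (Or.inr (Or.inl hE))
  by_cases hO : ∃ j, (2 ≤ j ∧ j < 2 + (2 * k - 3)) ∧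
      (x = 2 * j + 1 ∨ x + j + 1 = 10 * k + 6 ∨ x = 10 * k + 6 + j)
  · exact Or.inr (Or.inr (Or.inr hO))
  left
  rw [not_exists] at hE hO
  -- Each form of difference determines its index from `x`, so these instances carry all of `hE` and
  -- `hO` in a form usable by `omega`.
  have e1 := hE (x / 2)
  have e2 := hE (6 * k + 3 - x)
  have e3 := hE (x - (6 * k + 3))
  have o1 := hO (x / 2)
  have o2 := hO (10 * k + 5 - x)
  have o3 := hO (x - (10 * k + 6))
  clear hE hO
  have hx : x = 1 ∨ x = 3 ∨ x = 4 * k - 1 ∨ x = 4 * k ∨ x = 4 * k + 2 ∨ x = 4 * k + 3 ∨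
      x = 10 * k + 4 ∨ x = 10 * k + 5 ∨ x = 10 * k + 6 ∨ x = 10 * k + 7 := by
    omega
  clear e1 e2 e3 o1 o2 o3
  simp only [List.mem_cons, List.not_mem_nil, or_false, exists_eq_left, Finset.mem_insert,
    Finset.mem_singleton, exists_eq_or_imp]
  omega

/-- Here 23 values are left over: 20 for two quintuples and 3 for one sporadic triple. -/
theorem exists_isCyclicDifferenceFamily_six_mul_add_five {k : ℕ} (hk : 2 ≤ k) :
    ∃ 𝓕 : Multiset (Finset (ZMod (4 * (6 * k + 5)))),
      IsCyclicDifferenceFamily 4 (6 * k + 5) {3, 5} 𝓕 := by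
  refine exists_isCyclicDifferenceFamily_of_regular (s := 10 * k + 9) (l := 2) (m := 2 * k - 2)
    (l' := 2) (m' := 2 * k - 3) (by omega)
    [(1, 4 * k, 4 * k + 3, 16 * k + 12), (4 * k + 1, 8 * k + 6, 14 * k + 10, 18 * k + 14)]
    [(2, 8 * k + 7)] (by simp; omega) (by simp; omega) (by omega) (by omega) (by omega) (by omega)
    (by simp only [List.length_cons, List.length_nil]; omega) fun x h0 h2 h1 => ?_
  by_cases hS : x = 2 ∨ x = 8 * k + 5 ∨ x = 8 * k + 7
  · right; left
    simp only [List.mem_cons, List.not_mem_nil, or_false, exists_eq_left]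
    omega
  by_cases hE : ∃ i, (2 ≤ i ∧ i < 2 + (2 * k - 2)) ∧
      (x = 2 * i ∨ x + i = 6 * k + 5 ∨ x = 6 * k + 5 + i)
  · exact Or.inr (Or.inr (Or.inl hE))
  by_cases hO : ∃ j, (2 ≤ j ∧ j < 2 + (2 * k - 3)) ∧
      (x = 2 * j + 1 ∨ x + j + 1 = 10 * k + 9 ∨ x = 10 * k + 9 + j)
  · exact Or.inr (Or.inr (Or.inr hO))
  left
  rw [not_exists] at hE hO
  have e1 := hE (x / 2)
  have e2 := hE (6 * k + 5 - x)
  have e3 := hE (x - (6 * k + 5))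
  have o1 := hO (x / 2)
  have o2 := hO (10 * k + 8 - x)
  have o3 := hO (x - (10 * k + 9))
  clear hE hO
  -- The parenthesized group holds the differences of the first quintuple, the rest those of the
  -- second.
  have hx : (x = 1 ∨ x = 3 ∨ x = 4 * k - 1 ∨ x = 4 * k ∨ x = 4 * k + 2 ∨ x = 4 * k + 3 ∨
      x = 8 * k + 8 ∨ x = 8 * k + 9 ∨ x = 12 * k + 8 ∨ x = 12 * k + 9) ∨
      x = 4 * k + 1 ∨ x = 4 * k + 4 ∨ x = 4 * k + 5 ∨ x = 6 * k + 4 ∨ x = 6 * k + 6 ∨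
      x = 8 * k + 6 ∨ x = 10 * k + 7 ∨ x = 10 * k + 8 ∨ x = 10 * k + 9 ∨ x = 10 * k + 10 := by
    omega
  clear e1 e2 e3 o1 o2 o3
  simp only [List.mem_cons, List.not_mem_nil, or_false, exists_eq_left, Finset.mem_insert,
    Finset.mem_singleton, exists_eq_or_imp]
  omega

theorem exists_isCyclicDifferenceFamily_nine :
    ∃ 𝓕 : Multiset (Finset (ZMod (4 * 9))), IsCyclicDifferenceFamily 4 9 {3, 5} 𝓕 := by
  refine exists_isCyclicDifferenceFamily_of_lists (by norm_num) [(1, 3, 8, 24)] [(4, 14), (6, 17)]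
    (by decide) (by decide) (by decide) fun x h0 h2 h1 => ?_
  simp only [List.mem_cons, List.not_mem_nil, or_false, exists_eq_left, Finset.mem_insert,
    Finset.mem_singleton, exists_eq_or_imp]
  interval_cases x <;> omega

theorem lemma4p15 (t : ℕ) (ht_odd : Odd t) (ht_ge : 7 ≤ t) (ht_ne : t ≠ 11) :
    ∃ 𝓕 : Multiset (Finset (ZMod (4 * t))), IsCyclicDifferenceFamily 4 t {3, 5} 𝓕 := by
  have hmod : t % 6 = 1 ∨ t % 6 = 3 ∨ t % 6 = 5 := by
    obtain ⟨m, rfl⟩ := ht_odd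
    omega
  rcases hmod with h | h | h
  · obtain ⟨k, rfl⟩ : ∃ k, t = 6 * k + 1 := ⟨t / 6, by omega⟩
    exact exists_isCyclicDifferenceFamily_six_mul_add_one (by omega)
  · obtain ⟨k, rfl⟩ : ∃ k, t = 6 * k + 3 := ⟨t / 6, by omega⟩
    rcases Nat.lt_or_ge k 2 with hk | hk
    · obtain rfl : k = 1 := by omega
      exact exists_isCyclicDifferenceFamily_nine
    · exact exists_isCyclicDifferenceFamily_six_mul_add_three hk
  · obtain ⟨k, rfl⟩ : ∃ k, t = 6 * k + 5 := ⟨t / 6, by omega⟩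
    -- `k = 0, 1` would be `t = 5, 11`, both excluded.
    exact exists_isCyclicDifferenceFamily_six_mul_add_five (by omega)
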